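/- Write $e(x)=e^{2\pi i x}$. Let $f$ be a Steinhaus random multiplicative function: $(f(p))_{p\text{ prime}}$ are independent random variables, each uniformly distributed on the unit circle $\{z\in\mathbb C:|z|=1\}$, and $f(n)=\prod_{p\mid n}f(p)^{v_p(n)}$ for every $n\ge 1$, where $v_p(n)$ is the exponent of $p$ in $n$. For a positive integer $N$ let \[ \mathcal D=\mathcal D_N=\Bigl\{\frac aq+\frac{j}{4\pi N}:\ q\le 4\pi\sqrt N,\ 1\le a\le q,\ (a,q)=1,\ j\in\Bigl[-\frac{\sqrt N}{q},\frac{\sqrt N}{q}\Bigr]\cap\mathbb Z\Bigr\}, \] where $q$ and $a$ are positive integers. Then there is an absolute constant $C>0$ such that, for every $\varepsilon>0$, with probability $1-o_\varepsilon(1)$ as $N\to\infty$ one has \[ \max_{\theta\in\mathcal D}\ \frac1N\sum_{N^{0.8}\le p\le N}\Bigl|\sum_{m\le N/p}f(m)\,e(mp\theta)\Bigr|^2\ \le\ C(\log N)^{5/2+\varepsilon}. \] Here $p$ runs over primes, $m$ over positive integers, and $o_\varepsilon(1)$ denotes a function of $N$ depending only on $\varepsilon$ that tends to $0$ as $N\to\infty$.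 -/

import Mathlib

open MeasureTheory ProbabilityTheory Filter Topology

noncomputable section

namespace SteinhausPoly

/-- The additive character `e(x) = exp(2πix)`. -/
def e (x : ℝ) : ℂ := Complex.exp (2 * Real.pi * Complex.I * x)

/-- The uniform distribution on the unit circle `{z : ℂ | |z| = 1}`, as a measure on `ℂ`: the law of
`e(U)` with `U` uniform on `(0, 1]`. -/
def uniformUnitCircle : Measure ℂ :=
  ((volume : Measure ℝ).restrict (Set.Ioc 0 1)).map e

/-- `f` is a Steinhaus random multiplicative function on the probability space `(Ω, μ)`: the `f p`,
`p` prime, are independent random variables that are uniformly distributed on the unit circle, and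
`f n = ∏_{p ∣ n} f(p)^{v_p(n)}` for all `n ≥ 1`. (The value of `f` at `0` is irrelevant.) -/
structure IsSteinhaus {Ω : Type*} [MeasurableSpace Ω] (μ : Measure Ω) (f : ℕ → Ω → ℂ) : Prop where
  measurable_prime : ∀ p : ℕ, p.Prime → Measurable (f p)
  map_prime : ∀ p : ℕ, p.Prime → μ.map (f p) = uniformUnitCircle
  indep : iIndepFun (fun p : Nat.Primes => f (p : ℕ)) μ
  apply_eq_prod : ∀ n : ℕ, n ≠ 0 → ∀ ω : Ω,
    f n ω = ∏ p ∈ n.primeFactors, f p ω ^ n.factorization p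

/-- The set `𝒟` of the points `a/q + j/(4πN)` with `q ≤ 4π√N`, `1 ≤ a ≤ q`, `(a, q) = 1` and
`j ∈ [-√N/q, √N/q] ∩ ℤ`. -/
def pointSet (N : ℕ) : Set ℝ :=
  {θ | ∃ q a : ℕ, ∃ j : ℤ,
    (q : ℝ) ≤ 4 * Real.pi * √(N : ℝ) ∧ 1 ≤ a ∧ a ≤ q ∧ a.Coprime q ∧
    -√(N : ℝ) / q ≤ j ∧ (j : ℝ) ≤ √(N : ℝ) / q ∧
    θ = (a : ℝ) / q + j / (4 * Real.pi * N)}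

/-- The quantity `N⁻¹ ∑_{N^{0.8} ≤ p ≤ N} |∑_{m ≤ N/p} g(m) e(mpθ)|²`, where `p` runs over primes
and `m` over positive integers (so that `m ≤ N/p` if and only if `m ≤ ⌊N/p⌋`). -/
def condVariance (N : ℕ) (g : ℕ → ℂ) (θ : ℝ) : ℝ :=
  (1 / (N : ℝ)) *
    ∑ p ∈ (Finset.Icc 1 N).filter (fun p : ℕ => p.Prime ∧ (N : ℝ) ^ (0.8 : ℝ) ≤ (p : ℝ)),
      ‖∑ m ∈ (Finset.Icc 1 (N / p) : Finset ℕ), g m * e ((m : ℝ) * (p : ℝ) * θ)‖ ^ 2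

end SteinhausPoly

end

open scoped ComplexConjugate

namespace SteinhausPoly

/-! By positivity the primes may be replaced by all integers n ≥ N^0.8. Expanding the square gives a
sum over m₁, m₂ ≤ N^0.2 of f(m₁) conj f(m₂) times a geometric sum in n with frequency (m₁ - m₂)θ
(`condVariance_le_norm`). At θ = a/q + β the diagonal costs O(N log N), and pairs with q ∤ m₁ - m₂
cost at most q each, O(N) in all. If q ∣ m₁ - m₂, the fraction a/q drops out, so the remaining form
`offDiag` depends on (q, j) alone and no union over a is needed (`condVariance_le`).

Only this form needs randomness. Since |f| = 1, f(m₁) conj f(m₂) depends only on m₁/m₂ in lowest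
terms, and these products are orthonormal. Summing the coefficients over each ratio gives a second
moment ≪ (log N)³ σ(q) / (q² (1 + |j|)), by `integral_norm_offDiag_sq_le`. Summing over q and j
costs two more logarithms. Chebyshev and a union bound at height (log N)^(5/2+ε) then leave a
failure probability ≪ (log N)^(-2ε). -/

/-! ### The additive character and the moments of the uniform law on the circle. -/

lemma e_add (x y : ℝ) : e (x + y) = e x * e y := by
  simp only [e, ← Complex.exp_add]
  congr 1
  push_cast
  ring

lemma e_intCast (n : ℤ) : e n = 1 := by
  rw [e, Complex.exp_eq_one_iff]
  exact ⟨n, by push_cast; ring⟩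

lemma e_nat_mul (n : ℕ) (x : ℝ) : e (n * x) = e x ^ n := by
  rw [e, e, ← Complex.exp_nat_mul]
  congr 1
  push_cast
  ring

lemma e_eq_exp_ofReal (x : ℝ) : e x = Complex.exp (Complex.I * ((2 * Real.pi * x : ℝ) : ℂ)) := by
  rw [e]
  congr 1
  push_cast
  ring

lemma norm_e (x : ℝ) : ‖e x‖ = 1 := by
  rw [e_eq_exp_ofReal, Complex.norm_exp_I_mul_ofReal]

lemma conj_e (x : ℝ) : conj (e x) = e (-x) := by
  rw [e, e, ← Complex.exp_conj]
  congr 1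
  simp [map_ofNat]

lemma continuous_e : Continuous e := by
  unfold e
  fun_prop

lemma integral_e_int_mul {k : ℤ} (hk : k ≠ 0) :
    ∫ x in Set.Ioc (0 : ℝ) 1, e (k * x) = 0 := by
  rw [← intervalIntegral.integral_of_le zero_le_one]
  have hc : (2 * Real.pi * Complex.I * k : ℂ) ≠ 0 := by
    simp [Real.pi_ne_zero, hk]
  have h : ∀ x : ℝ, e (k * x) = Complex.exp ((2 * Real.pi * Complex.I * k : ℂ) * x) := by
    intro x
    rw [e]
    congr 1
    push_cast
    ring
  simp_rw [h]
  rw [integral_exp_mul_complex hc]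
  have h1 : Complex.exp ((2 * Real.pi * Complex.I * k : ℂ) * (1 : ℝ)) = 1 := by
    rw [Complex.exp_eq_one_iff]
    exact ⟨k, by push_cast; ring⟩
  rw [h1]
  simp

lemma integral_uniformUnitCircle_pow {k l : ℕ} (hkl : k ≠ l) :
    ∫ z, z ^ k * conj z ^ l ∂uniformUnitCircle = 0 := by
  rw [uniformUnitCircle, integral_map continuous_e.aemeasurable
    (by fun_prop : Continuous fun z : ℂ => z ^ k * conj z ^ l).aestronglyMeasurable]
  have h : ∀ x : ℝ, e x ^ k * conj (e x) ^ l = e (((k : ℤ) - (l : ℤ) : ℤ) * x) := by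
    intro x
    rw [conj_e, ← e_nat_mul, ← e_nat_mul, ← e_add]
    congr 1
    push_cast
    ring
  simp_rw [h]
  exact integral_e_int_mul (by omega)

lemma ae_norm_uniformUnitCircle : ∀ᵐ z ∂uniformUnitCircle, ‖z‖ = 1 := by
  rw [uniformUnitCircle, ae_map_iff continuous_e.aemeasurable
    (measurableSet_eq_fun measurable_norm measurable_const)]
  exact ae_of_all _ norm_e

/-! ### Orthogonality of Steinhaus random multiplicative functions. -/

/-- The pair of coprime integers with the same ratio. -/
def coprimePart (x : ℕ × ℕ) : ℕ × ℕ := (x.1 / x.1.gcd x.2, x.2 / x.1.gcd x.2)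

lemma coprimePart_ne_zero {x : ℕ × ℕ} (hx : x.1 ≠ 0 ∧ x.2 ≠ 0) :
    (coprimePart x).1 ≠ 0 ∧ (coprimePart x).2 ≠ 0 := by
  have hg : 0 < x.1.gcd x.2 := Nat.gcd_pos_of_pos_left _ hx.1.bot_lt
  exact ⟨(Nat.div_pos (Nat.gcd_le_left _ hx.1.bot_lt) hg).ne',
    (Nat.div_pos (Nat.gcd_le_right _ hx.2.bot_lt) hg).ne'⟩

namespace IsSteinhaus

variable {Ω : Type*} [MeasurableSpace Ω] {μ : Measure Ω} {f : ℕ → Ω → ℂ}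

lemma measurable (hf : IsSteinhaus μ f) {n : ℕ} (hn : n ≠ 0) : Measurable (f n) := by
  rw [show f n = fun ω => ∏ p ∈ n.primeFactors, f p ω ^ n.factorization p from
    funext (hf.apply_eq_prod n hn)]
  exact Finset.measurable_fun_prod _ fun p hp =>
    (hf.measurable_prime p (Nat.prime_of_mem_primeFactors hp)).pow_const _

lemma apply_eq_prod_of_subset (hf : IsSteinhaus μ f) {n : ℕ} (hn : n ≠ 0) {S : Finset ℕ}
    (hS : n.primeFactors ⊆ S) (ω : Ω) : f n ω = ∏ p ∈ S, f p ω ^ n.factorization p := by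
  rw [hf.apply_eq_prod n hn]
  refine Finset.prod_subset hS fun p _ hp => ?_
  rw [← Nat.support_factorization, Finsupp.notMem_support_iff] at hp
  rw [hp, pow_zero]

lemma map_mul (hf : IsSteinhaus μ f) {a b : ℕ} (ha : a ≠ 0) (hb : b ≠ 0) (ω : Ω) :
    f (a * b) ω = f a ω * f b ω := by
  have h := Nat.primeFactors_mul ha hb
  rw [hf.apply_eq_prod_of_subset (mul_ne_zero ha hb) h.subset,
    hf.apply_eq_prod_of_subset ha Finset.subset_union_left,
    hf.apply_eq_prod_of_subset hb Finset.subset_union_right, ← Finset.prod_mul_distrib]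
  refine Finset.prod_congr rfl fun p _ => ?_
  rw [Nat.factorization_mul ha hb, Finsupp.add_apply, pow_add]

lemma mul_conj_eq (hf : IsSteinhaus μ f) {A : Finset (ℕ × ℕ)}
    (hA : ∀ x ∈ A, x.1 ≠ 0 ∧ x.2 ≠ 0) (C : ℕ × ℕ → ℂ) (ω : Ω) :
    ((‖∑ x ∈ A, C x * (f x.1 ω * conj (f x.2 ω))‖ ^ 2 : ℝ) : ℂ) =
      ∑ x ∈ A, ∑ y ∈ A, C x * conj (C y) *
        (f (x.1 * y.2) ω * conj (f (x.2 * y.1) ω)) := by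
  rw [Complex.ofReal_pow, ← Complex.mul_conj', map_sum, Finset.sum_mul_sum]
  refine Finset.sum_congr rfl fun x hx => Finset.sum_congr rfl fun y hy => ?_
  rw [hf.map_mul (hA x hx).1 (hA y hy).2, hf.map_mul (hA x hx).2 (hA y hy).1]
  simp only [_root_.map_mul, Complex.conj_conj]
  ring

lemma ae_norm_eq_one (hf : IsSteinhaus μ f) : ∀ᵐ ω ∂μ, ∀ n : ℕ, n ≠ 0 → ‖f n ω‖ = 1 := by
  have h : ∀ᵐ ω ∂μ, ∀ p : ℕ, p.Prime → ‖f p ω‖ = 1 := by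
    refine ae_all_iff.2 fun p => ?_
    by_cases hp : p.Prime
    · have := ae_norm_uniformUnitCircle
      rw [← hf.map_prime p hp] at this
      filter_upwards [ae_of_ae_map (hf.measurable_prime p hp).aemeasurable this] with ω hω _
      exact hω
    · exact ae_of_all _ fun _ h => absurd h hp
  filter_upwards [h] with ω hω n hn
  rw [hf.apply_eq_prod n hn, norm_prod]
  refine Finset.prod_eq_one fun p hp => ?_
  rw [norm_pow, hω p (Nat.prime_of_mem_primeFactors hp), one_pow]

/-- Independence factors the expectation over primes, and a prime whose exponents in a and b differ
contributes a vanishing moment. -/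
lemma integral_mul_conj_of_ne (hf : IsSteinhaus μ f) {a b : ℕ} (ha : a ≠ 0) (hb : b ≠ 0)
    (hab : a ≠ b) : ∫ ω, f a ω * conj (f b ω) ∂μ = 0 := by
  obtain ⟨p, hp⟩ : ∃ p, a.factorization p ≠ b.factorization p := by
    by_contra! h
    exact hab (Nat.eq_of_factorization_eq ha hb h)
  set S := a.primeFactors ∪ b.primeFactors with hS
  have hSp : ∀ i ∈ S, i.Prime := fun i hi => by
    rcases Finset.mem_union.1 hi with h | h <;> exact Nat.prime_of_mem_primeFactors h
  have hpS : p ∈ S := by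
    by_contra h
    rw [hS, Finset.mem_union, ← Nat.support_factorization, ← Nat.support_factorization,
      Finsupp.mem_support_iff, Finsupp.mem_support_iff] at h
    omega
  have hprod : ∀ ω, f a ω * conj (f b ω) =
      ∏ i : S, (fun z : ℂ => z ^ a.factorization i * conj z ^ b.factorization i) (f i ω) := by
    intro ω
    rw [hf.apply_eq_prod_of_subset ha (S := S) Finset.subset_union_left,
      hf.apply_eq_prod_of_subset hb (S := S) Finset.subset_union_right, map_prod,
      ← Finset.prod_mul_distrib, ← Finset.prod_coe_sort S]
    simp
  have hind : iIndepFun (fun i : S => f i) μ :=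
    hf.indep.precomp (g := fun i : S => (⟨i, hSp i i.2⟩ : Nat.Primes)) fun i j h => by
      exact Subtype.ext (congrArg (fun p : Nat.Primes => (p : ℕ)) h)
  have hcont : ∀ k l : ℕ, Continuous fun z : ℂ => z ^ k * conj z ^ l := fun k l => by fun_prop
  rw [integral_congr_ae (ae_of_all _ hprod), hind.integral_fun_prod_comp (f := fun (i : S) (z : ℂ) =>
      z ^ a.factorization i * conj z ^ b.factorization i)
    (fun i => (hf.measurable_prime i (hSp i i.2)).aemeasurable)
    (fun i => (hcont _ _).aestronglyMeasurable)]
  refine Finset.prod_eq_zero (Finset.mem_univ ⟨p, hpS⟩) ?_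
  have hm := hf.map_prime p (hSp p hpS)
  have := integral_uniformUnitCircle_pow hp
  rw [← hm, integral_map (hf.measurable_prime p (hSp p hpS)).aemeasurable
    (hcont _ _).aestronglyMeasurable] at this
  exact this

variable [IsProbabilityMeasure μ]

lemma integral_mul_conj_self (hf : IsSteinhaus μ f) {a : ℕ} (ha : a ≠ 0) :
    ∫ ω, f a ω * conj (f a ω) ∂μ = 1 := by
  have : ∀ᵐ ω ∂μ, f a ω * conj (f a ω) = 1 := by
    filter_upwards [hf.ae_norm_eq_one] with ω hω
    rw [Complex.mul_conj, Complex.normSq_eq_norm_sq, hω a ha]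
    simp
  rw [integral_congr_ae this]
  simp

lemma integrable_mul_conj (hf : IsSteinhaus μ f) {a b : ℕ} (ha : a ≠ 0) (hb : b ≠ 0) :
    Integrable (fun ω => f a ω * conj (f b ω)) μ := by
  refine Integrable.of_bound (C := 1) ?_ ?_
  · exact ((hf.measurable ha).mul
      (Complex.continuous_conj.measurable.comp (hf.measurable hb))).aestronglyMeasurable
  · filter_upwards [hf.ae_norm_eq_one] with ω hω
    simp [hω a ha, hω b hb]

lemma integrable_norm_sq_sum (hf : IsSteinhaus μ f) {A : Finset (ℕ × ℕ)}
    (hA : ∀ x ∈ A, x.1 ≠ 0 ∧ x.2 ≠ 0) (C : ℕ × ℕ → ℂ) :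
    Integrable (fun ω => ‖∑ x ∈ A, C x * (f x.1 ω * conj (f x.2 ω))‖ ^ 2) μ := by
  have h : Integrable (fun ω =>
      ((‖∑ x ∈ A, C x * (f x.1 ω * conj (f x.2 ω))‖ ^ 2 : ℝ) : ℂ)) μ := by
    simp_rw [hf.mul_conj_eq hA C]
    exact integrable_finsetSum _ fun x hx => integrable_finsetSum _ fun y hy =>
      (hf.integrable_mul_conj (mul_ne_zero (hA x hx).1 (hA y hy).2)
        (mul_ne_zero (hA x hx).2 (hA y hy).1)).const_mul _
  exact h.re

/-- The products `f(r) conj f(s)` over coprime pairs `(r, s)` are orthonormal. -/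
lemma integral_norm_sq_sum_coprime (hf : IsSteinhaus μ f) {A : Finset (ℕ × ℕ)}
    (hA : ∀ x ∈ A, x.1 ≠ 0 ∧ x.2 ≠ 0) (hcop : ∀ x ∈ A, x.1.Coprime x.2) (C : ℕ × ℕ → ℂ) :
    ∫ ω, ‖∑ x ∈ A, C x * (f x.1 ω * conj (f x.2 ω))‖ ^ 2 ∂μ = ∑ x ∈ A, ‖C x‖ ^ 2 := by
  rw [← Complex.ofReal_inj, ← integral_complex_ofReal]
  simp_rw [hf.mul_conj_eq hA C]
  have hint : ∀ x ∈ A, ∀ y ∈ A, Integrable (fun ω => C x * conj (C y) *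
      (f (x.1 * y.2) ω * conj (f (x.2 * y.1) ω))) μ := fun x hx y hy =>
    (hf.integrable_mul_conj (mul_ne_zero (hA x hx).1 (hA y hy).2)
      (mul_ne_zero (hA x hx).2 (hA y hy).1)).const_mul _
  rw [integral_finsetSum _ fun x hx => integrable_finsetSum _ fun y hy => hint x hx y hy]
  push_cast
  refine Finset.sum_congr rfl fun x hx => ?_
  rw [integral_finsetSum _ fun y hy => hint x hx y hy, Finset.sum_eq_single_of_mem x hx]
  · rw [integral_const_mul, mul_comm x.2, hf.integral_mul_conj_self
      (mul_ne_zero (hA x hx).1 (hA x hx).2), mul_one, Complex.mul_conj']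
  · intro y hy hyx
    rw [integral_const_mul, hf.integral_mul_conj_of_ne (mul_ne_zero (hA x hx).1 (hA y hy).2)
      (mul_ne_zero (hA x hx).2 (hA y hy).1), mul_zero]
    intro h
    apply hyx
    -- A cross term survives only if x.1 / x.2 = y.1 / y.2; fractions in lowest terms are then
    -- identical.
    have h1 : x.1 ∣ y.1 := (hcop x hx).dvd_of_dvd_mul_left (Dvd.intro _ h)
    have h2 : y.1 ∣ x.1 := (hcop y hy).dvd_of_dvd_mul_right (Dvd.intro_left _ h.symm)
    have h3 := Nat.dvd_antisymm h2 h1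
    rw [h3, mul_comm x.2] at h
    exact Prod.ext h3 (Nat.eq_of_mul_eq_mul_left (Nat.pos_of_ne_zero (hA x hx).1) h)

/-- Almost surely f(gr) conj f(gs) = f(r) conj f(s), so pairs with the same reduced ratio merge into
one term before orthonormality is applied. -/
lemma integral_norm_sq_sum (hf : IsSteinhaus μ f) {A : Finset (ℕ × ℕ)}
    (hA : ∀ x ∈ A, x.1 ≠ 0 ∧ x.2 ≠ 0) (C : ℕ × ℕ → ℂ) :
    ∫ ω, ‖∑ x ∈ A, C x * (f x.1 ω * conj (f x.2 ω))‖ ^ 2 ∂μ =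
      ∑ y ∈ A.image coprimePart, ‖∑ x ∈ A with coprimePart x = y, C x‖ ^ 2 := by
  have hB : ∀ y ∈ A.image coprimePart, y.1 ≠ 0 ∧ y.2 ≠ 0 := by
    simp only [Finset.mem_image]
    rintro y ⟨x, hx, rfl⟩
    exact coprimePart_ne_zero (hA x hx)
  have hcop : ∀ y ∈ A.image coprimePart, y.1.Coprime y.2 := by
    simp only [Finset.mem_image]
    rintro y ⟨x, hx, rfl⟩
    exact Nat.coprime_div_gcd_div_gcd (Nat.gcd_pos_of_pos_left _ (hA x hx).1.bot_lt)
  rw [← hf.integral_norm_sq_sum_coprime hB hcop]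
  refine integral_congr_ae ?_
  filter_upwards [hf.ae_norm_eq_one] with ω hω
  rw [← Finset.sum_fiberwise_of_maps_to (g := coprimePart)
    (fun x hx => Finset.mem_image_of_mem _ hx)]
  congr 2
  refine Finset.sum_congr rfl fun y hy => ?_
  rw [Finset.sum_mul]
  refine Finset.sum_congr rfl fun x hx => ?_
  obtain ⟨hxA, rfl⟩ := Finset.mem_filter.1 hx
  have hg : x.1.gcd x.2 ≠ 0 := Nat.gcd_ne_zero_left (hA x hxA).1
  have hp := coprimePart_ne_zero (hA x hxA)
  have h1 : x.1 = x.1.gcd x.2 * (coprimePart x).1 :=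
    (Nat.mul_div_cancel' (Nat.gcd_dvd_left _ _)).symm
  have h2 : x.2 = x.1.gcd x.2 * (coprimePart x).2 :=
    (Nat.mul_div_cancel' (Nat.gcd_dvd_right _ _)).symm
  conv_lhs => rw [h1, hf.map_mul hg hp.1]
  conv_lhs => enter [2, 2]; rw [h2, hf.map_mul hg hp.2]
  have h3 : f (x.1.gcd x.2) ω * conj (f (x.1.gcd x.2) ω) = 1 := by
    rw [Complex.mul_conj', hω _ hg]
    simp
  rw [_root_.map_mul]
  linear_combination C x * f (coprimePart x).1 ω * conj (f (coprimePart x).2 ω) * h3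

end IsSteinhaus

/-! ### Harmonic, gcd and divisor sums. -/

lemma sum_le_sum_of_injOn {ι κ : Type*} {s : Finset ι} {t : Finset κ}
    {F : ι → ℝ} {G : κ → ℝ} (φ : ι → κ) (hφ : ∀ x ∈ s, φ x ∈ t) (hinj : Set.InjOn φ s)
    (hFG : ∀ x ∈ s, F x ≤ G (φ x)) (hG : ∀ y ∈ t, 0 ≤ G y) :
    ∑ x ∈ s, F x ≤ ∑ y ∈ t, G y := by
  classical
  calc ∑ x ∈ s, F x ≤ ∑ x ∈ s, G (φ x) := Finset.sum_le_sum hFG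
    _ = ∑ y ∈ s.image φ, G y := (Finset.sum_image hinj).symm
    _ ≤ ∑ y ∈ t, G y := Finset.sum_le_sum_of_subset_of_nonneg (Finset.image_subset_iff.2 hφ)
        fun y hy _ => hG y hy

lemma sum_Icc_inv_le (n : ℕ) : ∑ k ∈ Finset.Icc 1 n, (1 / k : ℝ) ≤ 1 + Real.log n := by
  have := harmonic_le_one_add_log n
  rw [harmonic_eq_sum_Icc] at this
  push_cast at this
  simpa using this

/-- With d = gcd(q, h), the condition forces g to be a multiple of u = q/d; writing g = uk extracts
the factor d/q. -/
lemma sum_inv_filter_dvd_mul_le {q h : ℕ} (hq : 0 < q) (M : ℕ) :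
    ∑ g ∈ Finset.Icc 1 M with q ∣ g * h, (1 / g : ℝ) ≤
      (q.gcd h : ℝ) / q * ∑ k ∈ Finset.Icc 1 M, (1 / k : ℝ) := by
  obtain ⟨d, hd⟩ : ∃ d, d = q.gcd h := ⟨_, rfl⟩
  have hd0 : 0 < d := hd ▸ Nat.gcd_pos_of_pos_left _ hq
  obtain ⟨u, hu⟩ : d ∣ q := hd ▸ Nat.gcd_dvd_left q h
  obtain ⟨v, hv⟩ : d ∣ h := hd ▸ Nat.gcd_dvd_right q h
  have hu0 : 0 < u := Nat.pos_of_ne_zero fun h0 => by simp [h0] at hu; omega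
  have huv : u.Coprime v := by
    have := Nat.coprime_div_gcd_div_gcd (m := q) (n := h) (hd ▸ hd0)
    rwa [← hd, hu, hv, Nat.mul_div_cancel_left _ hd0, Nat.mul_div_cancel_left _ hd0] at this
  have hdvd : ∀ g, q ∣ g * h → u ∣ g := by
    intro g hg
    rw [hu, hv, mul_left_comm] at hg
    exact huv.dvd_of_dvd_mul_right (Nat.dvd_of_mul_dvd_mul_left hd0 hg)
  rw [← hd, Finset.mul_sum]
  refine sum_le_sum_of_injOn (fun g => g / u) ?_ ?_ ?_ fun _ _ => by positivity
  · intro g hg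
    simp only [Finset.mem_filter, Finset.mem_Icc] at hg ⊢
    obtain ⟨k, rfl⟩ := hdvd g hg.2
    rw [Nat.mul_div_cancel_left _ hu0]
    have : k ≠ 0 := by rintro rfl; simp at hg
    exact ⟨by omega, (Nat.le_mul_of_pos_left k hu0).trans hg.1.2⟩
  · intro a ha b hb hab
    simp only [Finset.coe_filter, Set.mem_ofPred_eq] at ha hb
    exact (Nat.div_left_inj (hdvd a ha.2) (hdvd b hb.2)).1 hab
  · intro g hg
    simp only [Finset.mem_filter, Finset.mem_Icc] at hg
    obtain ⟨k, rfl⟩ := hdvd g hg.2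
    rw [Nat.mul_div_cancel_left _ hu0, hu]
    have : k ≠ 0 := by rintro rfl; simp at hg
    apply le_of_eq
    push_cast
    field_simp

/-- Telescoping: with A the preceding denominator, 1/(A + dJ)² ≤ 1/(A(A + dJ)). -/
lemma sum_inv_sq_arith_le {r d J : ℝ} (hr : 0 < r) (hd : 0 < d) (hJ : 0 < J) (M : ℕ) :
    ∑ k ∈ Finset.Icc 1 M, d ^ 2 / (r + d * k * J) ^ 2 ≤ d / (r * J) := by
  have key : ∀ M : ℕ, ∑ k ∈ Finset.Icc 1 M, d ^ 2 / (r + d * k * J) ^ 2 ≤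
      d / J * (1 / r - 1 / (r + d * M * J)) := by
    intro M
    induction M with
    | zero => simp
    | succ n ih =>
      rw [Finset.sum_Icc_succ_top (by omega)]
      have h1 : d ^ 2 / (r + d * (n + 1 : ℕ) * J) ^ 2 ≤
          d / J * (1 / (r + d * n * J) - 1 / (r + d * (n + 1 : ℕ) * J)) := by
        have hA : 0 < r + d * n * J := by positivity
        have hB : r + d * (n + 1 : ℕ) * J = (r + d * n * J) + d * J := by push_cast; ring
        rw [hB]
        set A := r + d * n * J
        have : d / J * (1 / A - 1 / (A + d * J)) = d ^ 2 / (A * (A + d * J)) := by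
          field_simp
          ring
        rw [this]
        have : 0 < d * J := by positivity
        gcongr
        nlinarith
      linarith
  refine (key M).trans ?_
  have : 0 ≤ 1 / (r + d * M * J) := by positivity
  calc d / J * (1 / r - 1 / (r + d * M * J)) ≤ d / J * (1 / r) := by gcongr; linarith
    _ = d / (r * J) := by field_simp

/-- Sort h = dk by d = gcd(q, h) and drop the coprimality condition on k; each divisor d of q then
contributes at most d/(rJ). -/
lemma sum_gcd_sq_div_le {q : ℕ} (hq : 0 < q) {r J : ℝ} (hr : 0 < r) (hJ : 0 < J) (M : ℕ) :
    ∑ h ∈ Finset.Icc 1 M, (q.gcd h : ℝ) ^ 2 / (r + h * J) ^ 2 ≤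
      (∑ d ∈ q.divisors, (d : ℝ)) / (r * J) := by
  calc ∑ h ∈ Finset.Icc 1 M, (q.gcd h : ℝ) ^ 2 / (r + h * J) ^ 2
      ≤ ∑ x ∈ q.divisors ×ˢ Finset.Icc 1 M, (x.1 : ℝ) ^ 2 / (r + x.1 * x.2 * J) ^ 2 := by
        refine sum_le_sum_of_injOn (fun h => (q.gcd h, h / q.gcd h)) ?_ ?_ ?_
          fun _ _ => by positivity
        · intro h hh
          simp only [Finset.mem_Icc, Finset.mem_product, Nat.mem_divisors] at hh ⊢
          exact ⟨⟨Nat.gcd_dvd_left _ _, hq.ne'⟩,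
            Nat.div_pos (Nat.gcd_le_right _ hh.1) (Nat.gcd_pos_of_pos_left _ hq),
            (Nat.div_le_self _ _).trans hh.2⟩
        · intro a _ b _ hab
          simp only [Prod.mk.injEq] at hab
          rw [← Nat.mul_div_cancel' (Nat.gcd_dvd_right q a), hab.2, hab.1,
            Nat.mul_div_cancel' (Nat.gcd_dvd_right q b)]
        · intro h _
          have : (h : ℝ) = (q.gcd h : ℝ) * (h / q.gcd h : ℕ) := by
            exact_mod_cast (Nat.mul_div_cancel' (Nat.gcd_dvd_right q h)).symm
          conv_lhs => rw [this]
    _ = ∑ d ∈ q.divisors, ∑ k ∈ Finset.Icc 1 M, (d : ℝ) ^ 2 / (r + d * k * J) ^ 2 :=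
        Finset.sum_product _ _ _
    _ ≤ ∑ d ∈ q.divisors, (d : ℝ) / (r * J) := Finset.sum_le_sum fun d hd =>
        sum_inv_sq_arith_le hr (by exact_mod_cast Nat.pos_of_mem_divisors hd) hJ M
    _ = _ := (Finset.sum_div _ _ _).symm

/-- On each side of the diagonal a pair is determined by its larger entry r and the difference h.
The sum over h is `sum_gcd_sq_div_le`, and its 1/r produces the harmonic sum. -/
lemma sum_pairs_gcd_sq_div_le {q : ℕ} (hq : 0 < q) {J : ℝ} (hJ : 0 < J) (M : ℕ) :
    ∑ x ∈ Finset.Icc 1 M ×ˢ Finset.Icc 1 M with x.1 ≠ x.2,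
      (q.gcd ((x.1 : ℤ) - x.2).natAbs : ℝ) ^ 2 /
        ((max x.1 x.2 : ℕ) + (((x.1 : ℤ) - x.2).natAbs : ℝ) * J) ^ 2 ≤
      2 * ((∑ d ∈ q.divisors, (d : ℝ)) / J) * ∑ k ∈ Finset.Icc 1 M, (1 / k : ℝ) := by
  set F : ℕ × ℕ → ℝ := fun x => (q.gcd ((x.1 : ℤ) - x.2).natAbs : ℝ) ^ 2 /
        ((max x.1 x.2 : ℕ) + (((x.1 : ℤ) - x.2).natAbs : ℝ) * J) ^ 2 with hF
  set G : ℕ × ℕ → ℝ := fun y => (q.gcd y.2 : ℝ) ^ 2 / (y.1 + y.2 * J) ^ 2 with hG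
  set S := Finset.Icc 1 M ×ˢ Finset.Icc 1 M with hS
  have hG0 : ∀ y ∈ S, 0 ≤ G y := fun y _ => by simp only [hG]; positivity
  have hGsum : ∑ y ∈ S, G y ≤ (∑ d ∈ q.divisors, (d : ℝ)) / J *
      ∑ k ∈ Finset.Icc 1 M, (1 / k : ℝ) := by
    rw [hS, Finset.sum_product, Finset.mul_sum]
    refine Finset.sum_le_sum fun r hr => ?_
    have hr : 0 < (r : ℝ) := by exact_mod_cast (Finset.mem_Icc.1 hr).1
    refine (sum_gcd_sq_div_le hq hr hJ M).trans_eq ?_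
    field_simp
  have h1 : ∑ x ∈ S with x.2 < x.1, F x ≤ ∑ y ∈ S, G y := by
    refine sum_le_sum_of_injOn (fun x => (x.1, ((x.1 : ℤ) - x.2).natAbs)) ?_ ?_ ?_ hG0
    · intro x hx
      simp only [hS, Finset.mem_filter, Finset.mem_product, Finset.mem_Icc] at hx ⊢
      omega
    · intro x hx y hy hxy
      simp only [Finset.coe_filter, Set.mem_ofPred_eq, Prod.mk.injEq] at hx hy hxy
      exact Prod.ext hxy.1 (by omega)
    · intro x hx
      have := (Finset.mem_filter.1 hx).2
      simp only [hF, hG, max_eq_left this.le, le_refl]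
  have h2 : ∑ x ∈ S with x.1 < x.2, F x ≤ ∑ y ∈ S, G y := by
    refine sum_le_sum_of_injOn (fun x => (x.2, ((x.1 : ℤ) - x.2).natAbs)) ?_ ?_ ?_ hG0
    · intro x hx
      simp only [hS, Finset.mem_filter, Finset.mem_product, Finset.mem_Icc] at hx ⊢
      omega
    · intro x hx y hy hxy
      simp only [Finset.coe_filter, Set.mem_ofPred_eq, Prod.mk.injEq] at hx hy hxy
      exact Prod.ext (by omega) hxy.1
    · intro x hx
      have := (Finset.mem_filter.1 hx).2
      simp only [hF, hG, max_eq_right this.le, le_refl]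
  have h3 : ∑ x ∈ S with x.1 ≠ x.2, F x =
      ∑ x ∈ S with x.2 < x.1, F x + ∑ x ∈ S with x.1 < x.2, F x := by
    rw [← Finset.sum_union, ← Finset.filter_or]
    · refine Finset.sum_congr (Finset.filter_congr fun x _ => ?_) fun _ _ => rfl
      omega
    · refine Finset.disjoint_filter.2 fun x _ h => ?_
      omega
  rw [h3]
  linarith

/-- Writing q = dk turns d/q² into 1/(dk²), so the double sum is at most a product of a harmonic sum
and a convergent one. -/
lemma sum_sigma_div_sq_le (M : ℕ) :
    ∑ q ∈ Finset.Icc 1 M, (∑ d ∈ q.divisors, (d : ℝ)) / (q : ℝ) ^ 2 ≤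
      4 * ∑ k ∈ Finset.Icc 1 M, (1 / k : ℝ) := by
  -- The 4 comes from (1 + k)² ≤ 4k², which reduces to the telescoping bound with r = d = J = 1.
  have hsq : ∑ k ∈ Finset.Icc 1 M, 1 / (k : ℝ) ^ 2 ≤ 4 := by
    have h := sum_inv_sq_arith_le one_pos one_pos one_pos M
    have h2 : ∀ k ∈ Finset.Icc 1 M, 1 / (k : ℝ) ^ 2 ≤
        4 * ((1 : ℝ) ^ 2 / (1 + 1 * k * 1) ^ 2) := by
      intro k hk
      have hk : (1 : ℝ) ≤ k := by exact_mod_cast (Finset.mem_Icc.1 hk).1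
      rw [← mul_div_assoc, div_le_div_iff₀ (by positivity) (by positivity)]
      nlinarith
    refine (Finset.sum_le_sum h2).trans ?_
    rw [← Finset.mul_sum]
    linarith
  calc ∑ q ∈ Finset.Icc 1 M, (∑ d ∈ q.divisors, (d : ℝ)) / (q : ℝ) ^ 2
      = ∑ x ∈ (Finset.Icc 1 M).sigma fun q => q.divisors, (x.2 : ℝ) / (x.1 : ℝ) ^ 2 := by
        rw [Finset.sum_sigma]
        exact Finset.sum_congr rfl fun q _ => Finset.sum_div _ _ _
    _ ≤ ∑ y ∈ Finset.Icc 1 M ×ˢ Finset.Icc 1 M, 1 / (y.1 : ℝ) * (1 / (y.2 : ℝ) ^ 2) := by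
        refine sum_le_sum_of_injOn (fun x => (x.2, x.1 / x.2)) ?_ ?_ ?_ fun _ _ => by positivity
        · rintro ⟨q, d⟩ hx
          simp only [Finset.mem_sigma, Finset.mem_Icc, Nat.mem_divisors, Finset.mem_product]
            at hx ⊢
          have hd := Nat.le_of_dvd hx.1.1 hx.2.1
          have hd0 := Nat.pos_of_dvd_of_pos hx.2.1 hx.1.1
          exact ⟨⟨hd0, hd.trans hx.1.2⟩, Nat.div_pos hd hd0, (Nat.div_le_self _ _).trans hx.1.2⟩
        · rintro ⟨q, d⟩ hx ⟨q', d'⟩ hx' h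
          simp only [Finset.coe_sigma, Set.mem_sigma_iff, Finset.mem_coe, Nat.mem_divisors,
            Prod.mk.injEq] at hx hx' h
          obtain ⟨rfl, h⟩ := h
          rw [Nat.div_left_inj hx.2.1 hx'.2.1] at h
          rw [h]
        · rintro ⟨q, d⟩ hx
          simp only [Finset.mem_sigma, Finset.mem_Icc, Nat.mem_divisors] at hx
          obtain ⟨⟨hq, -⟩, ⟨k, rfl⟩, -⟩ := hx
          have hd : 0 < d := Nat.pos_of_mul_pos_right hq
          have hk : 0 < k := Nat.pos_of_mul_pos_left hq
          rw [Nat.mul_div_cancel_left _ hd]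
          apply le_of_eq
          push_cast
          field_simp
    _ = (∑ k ∈ Finset.Icc 1 M, (1 / k : ℝ)) * ∑ k ∈ Finset.Icc 1 M, 1 / (k : ℝ) ^ 2 := by
        rw [Finset.sum_product, Finset.sum_mul_sum]
    _ ≤ _ := by
        rw [mul_comm]
        gcongr

lemma sum_Icc_neg_inv_one_add_abs_le (s : ℕ) :
    ∑ j ∈ Finset.Icc (-s : ℤ) s, 1 / (1 + (j.natAbs : ℝ)) ≤
      2 * ∑ k ∈ Finset.Icc 1 (s + 1), (1 / k : ℝ) := by
  have h0 : ∀ y ∈ Finset.Icc 1 (s + 1), 0 ≤ (1 / y : ℝ) := fun _ _ => by positivity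
  rw [← Finset.sum_filter_add_sum_filter_not _ (fun j : ℤ => 0 ≤ j), two_mul]
  refine add_le_add (sum_le_sum_of_injOn (fun j => j.natAbs + 1) ?_ ?_ ?_ h0)
    (sum_le_sum_of_injOn (fun j => j.natAbs + 1) ?_ ?_ ?_ h0)
  · intro j hj
    simp only [Finset.mem_filter, Finset.mem_Icc] at hj ⊢
    omega
  · intro j hj k hk h
    simp only [Finset.coe_filter, Set.mem_ofPred_eq] at hj hk h
    omega
  · intro j _
    push_cast
    rw [add_comm]
  · intro j hj
    simp only [Finset.mem_filter, Finset.mem_Icc] at hj ⊢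
    omega
  · intro j hj k hk h
    simp only [Finset.coe_filter, Set.mem_ofPred_eq] at hj hk h
    omega
  · intro j _
    push_cast
    rw [add_comm]

/-! ### Geometric sums at and near rational points. -/

lemma four_mul_abs_le_norm_e_sub_one {x : ℝ} (hx : |x| ≤ 1 / 2) : 4 * |x| ≤ ‖e x - 1‖ := by
  rw [e_eq_exp_ofReal, Complex.norm_exp_I_mul_ofReal_sub_one, norm_mul, Real.norm_eq_abs,
    Real.norm_eq_abs, abs_two, show 2 * Real.pi * x / 2 = Real.pi * x by ring]
  have hπ := Real.pi_pos
  have h : |Real.pi * x| ≤ Real.pi / 2 := by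
    rw [abs_mul, abs_of_pos hπ]
    nlinarith
  have h2 := Real.mul_abs_le_abs_sin h
  rw [abs_mul, abs_of_pos hπ] at h2
  have : 2 / Real.pi * (Real.pi * |x|) = 2 * |x| := by field_simp
  linarith

/-- The exponential sum `∑_{Y ≤ n ≤ Z} e(nα)`. -/
noncomputable def expSum (Y Z : ℕ) (α : ℝ) : ℂ := ∑ n ∈ Finset.Icc Y Z, e (n * α)

lemma expSum_add_int (Y Z : ℕ) (α : ℝ) (k : ℤ) : expSum Y Z (α + k) = expSum Y Z α := by
  refine Finset.sum_congr rfl fun n _ => ?_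
  rw [mul_add, e_add, show (n : ℝ) * k = ((n * k : ℤ) : ℝ) by push_cast; rfl, e_intCast, mul_one]

lemma norm_expSum_le (Z : ℕ) {Y : ℕ} (hY : 1 ≤ Y) (α : ℝ) : ‖expSum Y Z α‖ ≤ Z := by
  refine (norm_sum_le _ _).trans ?_
  simp only [norm_e, Finset.sum_const, Nat.card_Icc, nsmul_eq_mul, mul_one]
  exact_mod_cast (by omega)

lemma norm_expSum_le_inv (Y Z : ℕ) {x : ℝ} (hx0 : x ≠ 0) (hx : |x| ≤ 1 / 2) :
    ‖expSum Y Z x‖ ≤ 1 / (2 * |x|) := by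
  have hpos : 0 < |x| := abs_pos.2 hx0
  have h4 := four_mul_abs_le_norm_e_sub_one hx
  have hne : e x ≠ 1 := fun h => by rw [h, sub_self, norm_zero] at h4; linarith
  unfold expSum
  simp_rw [e_nat_mul]
  rw [← Finset.Ico_add_one_right_eq_Icc]
  rcases le_or_gt Y (Z + 1) with hYZ | hYZ
  · rw [geom_sum_Ico hne hYZ, norm_div]
    have : ‖e x ^ (Z + 1) - e x ^ Y‖ ≤ 2 := by
      refine (norm_sub_le _ _).trans ?_
      simp only [norm_pow, norm_e, one_pow]
      norm_num
    calc _ ≤ 2 / (4 * |x|) := by gcongr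
      _ = _ := by field_simp; norm_num
  · rw [Finset.Ico_eq_empty (by omega)]
    simp

/-- `q` divides `h`: only the perturbation of the rational point matters. -/
lemma expSum_rat_add_of_dvd (Y Z : ℕ) {q : ℕ} (hq : q ≠ 0) {h : ℤ} (hqh : (q : ℤ) ∣ h) (a : ℕ)
    (β : ℝ) : expSum Y Z (h * ((a : ℝ) / q + β)) = expSum Y Z (h * β) := by
  obtain ⟨k, rfl⟩ := hqh
  rw [← expSum_add_int _ _ (_ * β) (k * a)]
  congr 1
  have : (q : ℝ) ≠ 0 := by exact_mod_cast hq
  push_cast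
  field_simp
  ring

/-- Here ha/q is not an integer, so it lies at distance at least 1/q from every integer. The
perturbation uses up at most half of this, and a geometric sum at distance 1/(2q) from ℤ is at most
q. -/
lemma norm_expSum_rat_add_le_of_not_dvd (Y Z : ℕ) {q a : ℕ} (hq : q ≠ 0) (haq : a.Coprime q)
    {h : ℤ} (hqh : ¬ (q : ℤ) ∣ h) {β : ℝ} (hβ : |h * β| ≤ 1 / (2 * q)) :
    ‖expSum Y Z (h * ((a : ℝ) / q + β))‖ ≤ q := by
  set α : ℝ := h * ((a : ℝ) / q + β) with hα
  have hq0 : (0 : ℝ) < q := by exact_mod_cast Nat.pos_of_ne_zero hq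
  have hx : 1 / (2 * q : ℝ) ≤ |α - round α| := by
    have h1 : (1 : ℤ) ≤ |h * a - round α * q| := by
      refine Int.one_le_abs fun h0 => hqh ?_
      have hd : (q : ℤ) ∣ h * a := ⟨round α, by linarith⟩
      exact (Nat.isCoprime_iff_coprime.2 haq.symm).dvd_of_dvd_mul_right hd
    have h2 : (1 : ℝ) ≤ |(h : ℝ) * a - round α * q| := by exact_mod_cast h1
    have h3 : α - round α = ((h : ℝ) * a - round α * q) / q + h * β := by
      rw [hα]
      field_simp
      ring
    have h4 : 1 / (q : ℝ) ≤ |((h : ℝ) * a - round α * q) / q| := by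
      rw [abs_div, abs_of_pos hq0]
      gcongr
    have h5 := abs_sub_abs_le_abs_sub (((h : ℝ) * a - round α * q) / q) (-(h * β))
    rw [abs_neg, sub_neg_eq_add, ← h3] at h5
    have h6 : 1 / (q : ℝ) = 1 / (2 * q) + 1 / (2 * q) := by field_simp; norm_num
    linarith
  have hx0 : 0 < |α - round α| := lt_of_lt_of_le (by positivity) hx
  have h := norm_expSum_le_inv Y Z (abs_pos.1 hx0) (abs_sub_round α)
  rw [← expSum_add_int _ _ _ (round α), sub_add_cancel] at h
  refine h.trans ?_
  rw [div_le_iff₀ (by positivity)] at hx ⊢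
  linarith

/-! ### Expansion of the square and reduction to congruent pairs. -/

/-- The range `⌊N^{0.2}⌋` of the inner variable. -/
noncomputable def innerRange (N : ℕ) : ℕ := ⌊(N : ℝ) ^ (0.2 : ℝ)⌋₊

/-- The start `⌈N^{0.8}⌉` of the range of the outer variable. -/
noncomputable def outerStart (N : ℕ) : ℕ := ⌈(N : ℝ) ^ (0.8 : ℝ)⌉₊

lemma rpow_mul_rpow_eq {N : ℕ} (hN : 0 < N) : (N : ℝ) ^ (0.2 : ℝ) * (N : ℝ) ^ (0.8 : ℝ) = N := by
  rw [← Real.rpow_add (by exact_mod_cast hN)]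
  norm_num

lemma outerStart_pos {N : ℕ} (hN : 0 < N) : 1 ≤ outerStart N :=
  Nat.ceil_pos.2 (Real.rpow_pos_of_pos (by exact_mod_cast hN) _)

lemma le_innerRange {N m n : ℕ} (hN : 0 < N) (hn : outerStart N ≤ n) (hmn : m * n ≤ N) :
    m ≤ innerRange N := by
  have hN' : (0 : ℝ) < N := by exact_mod_cast hN
  refine Nat.le_floor ?_
  have h1 : (N : ℝ) ^ (0.8 : ℝ) ≤ n := Nat.ceil_le.1 hn
  have h2 : (m : ℝ) * n ≤ N := by exact_mod_cast hmn
  have h3 : 0 < (N : ℝ) ^ (0.8 : ℝ) := Real.rpow_pos_of_pos hN' _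
  rw [← rpow_mul_rpow_eq hN] at h2
  refine le_of_mul_le_mul_right (le_trans ?_ h2) h3
  gcongr

/-- This makes the number of pairs times q ≤ 4π√N at most O(N). -/
lemma innerRange_sq_le_sqrt (N : ℕ) : (innerRange N : ℝ) ^ 2 ≤ √N := by
  rcases Nat.eq_zero_or_pos N with rfl | hN
  · simp only [innerRange, Nat.cast_zero]
    rw [Real.zero_rpow (by norm_num)]
    simp
  have hN' : (1 : ℝ) ≤ N := by exact_mod_cast hN
  calc (innerRange N : ℝ) ^ 2 ≤ ((N : ℝ) ^ (0.2 : ℝ)) ^ 2 := by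
        gcongr
        exact Nat.floor_le (by positivity)
    _ = (N : ℝ) ^ (0.4 : ℝ) := by
        rw [← Real.rpow_natCast, ← Real.rpow_mul (by positivity)]
        norm_num
    _ ≤ (N : ℝ) ^ (1 / 2 : ℝ) := Real.rpow_le_rpow_of_exponent_le hN' (by norm_num)
    _ = √N := (Real.sqrt_eq_rpow _).symm

lemma innerRange_le_sqrt (N : ℕ) : (innerRange N : ℝ) ≤ √N := by
  refine le_trans ?_ (innerRange_sq_le_sqrt N)
  exact_mod_cast Nat.le_self_pow two_ne_zero _

lemma innerRange_le (N : ℕ) : innerRange N ≤ N := by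
  have h := innerRange_sq_le_sqrt N
  have h2 := Real.sq_sqrt (Nat.cast_nonneg (α := ℝ) N)
  have h3 : (innerRange N : ℝ) ^ 2 ≤ N := by
    rcases Nat.eq_zero_or_pos N with rfl | hN
    · simpa using h
    · refine h.trans (Real.sqrt_le_iff.2 ⟨by positivity, by exact_mod_cast Nat.le_self_pow two_ne_zero N⟩)
  have h4 : (innerRange N) ^ 2 ≤ N := by exact_mod_cast h3
  exact (Nat.le_self_pow two_ne_zero _).trans h4

/-- The pairs of inner variables. -/
noncomputable def innerPairs (N : ℕ) : Finset (ℕ × ℕ) :=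
  Finset.Icc 1 (innerRange N) ×ˢ Finset.Icc 1 (innerRange N)

/-- Replacing the primes by all integers and expanding the square. -/
lemma condVariance_le_norm {N : ℕ} (hN : 0 < N) (g : ℕ → ℂ) (θ : ℝ) :
    condVariance N g θ ≤ 1 / N * ‖∑ x ∈ innerPairs N, g x.1 * conj (g x.2) *
      expSum (outerStart N) (N / max x.1 x.2) (((x.1 : ℤ) - x.2 : ℤ) * θ)‖ := by
  set Y := outerStart N
  set M := innerRange N
  have hY : 1 ≤ Y := outerStart_pos hN
  unfold condVariance
  gcongr
  have h1 : ∑ p ∈ (Finset.Icc 1 N).filter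
        (fun p : ℕ => p.Prime ∧ (N : ℝ) ^ (0.8 : ℝ) ≤ (p : ℝ)),
      ‖∑ m ∈ Finset.Icc 1 (N / p), g m * e ((m : ℝ) * (p : ℝ) * θ)‖ ^ 2 ≤
      ∑ n ∈ Finset.Icc Y N, ‖∑ m ∈ Finset.Icc 1 (N / n), g m * e ((m : ℝ) * (n : ℝ) * θ)‖ ^ 2 := by
    refine Finset.sum_le_sum_of_subset_of_nonneg ?_ fun _ _ _ => by positivity
    intro p hp
    simp only [Finset.mem_filter, Finset.mem_Icc] at hp ⊢
    exact ⟨Nat.ceil_le.2 hp.2.2, hp.1.2⟩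
  refine h1.trans ?_
  have h2 : ((∑ n ∈ Finset.Icc Y N,
      ‖∑ m ∈ Finset.Icc 1 (N / n), g m * e ((m : ℝ) * (n : ℝ) * θ)‖ ^ 2 : ℝ) : ℂ) =
      ∑ x ∈ innerPairs N, g x.1 * conj (g x.2) *
        expSum Y (N / max x.1 x.2) (((x.1 : ℤ) - x.2 : ℤ) * θ) := by
    rw [Complex.ofReal_sum]
    simp_rw [Complex.ofReal_pow]
    -- The conditions m₁, m₂ ≤ N/n amount to n ≤ N / max(m₁, m₂), so after exchanging sums the inner
    -- sum over n is a full geometric sum.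
    have h3 : ∀ n ∈ Finset.Icc Y N,
        (‖∑ m ∈ Finset.Icc 1 (N / n), g m * e ((m : ℝ) * (n : ℝ) * θ)‖ : ℂ) ^ 2 =
        ∑ x ∈ innerPairs N with n ≤ N / max x.1 x.2,
          g x.1 * conj (g x.2) * e (n * (((x.1 : ℤ) - x.2 : ℤ) * θ)) := by
      intro n hn
      have hn0 : 0 < n := hY.trans (Finset.mem_Icc.1 hn).1
      rw [← Complex.mul_conj', map_sum, Finset.sum_mul_sum, ← Finset.sum_product']
      refine Finset.sum_congr ?_ fun x _ => ?_
      · ext ⟨a, b⟩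
        simp only [innerPairs, Finset.mem_product, Finset.mem_Icc, Finset.mem_filter]
        constructor
        · rintro ⟨⟨ha, ha'⟩, hb, hb'⟩
          rw [Nat.le_div_iff_mul_le hn0] at ha' hb'
          refine ⟨⟨⟨ha, le_innerRange hN (Finset.mem_Icc.1 hn).1 ha'⟩,
            ⟨hb, le_innerRange hN (Finset.mem_Icc.1 hn).1 hb'⟩⟩, ?_⟩
          rw [Nat.le_div_iff_mul_le (by omega)]
          rcases max_choice a b with h | h <;> rw [h] <;> linarith
        · rintro ⟨⟨⟨ha, -⟩, hb, -⟩, h⟩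
          rw [Nat.le_div_iff_mul_le (by omega)] at h
          rw [Nat.le_div_iff_mul_le hn0, Nat.le_div_iff_mul_le hn0]
          have h4 := Nat.mul_le_mul_left n (le_max_left a b)
          have h5 := Nat.mul_le_mul_left n (le_max_right a b)
          exact ⟨⟨ha, by linarith⟩, hb, by linarith⟩
      · rw [map_mul, conj_e, mul_mul_mul_comm, ← e_add]
        congr 2
        push_cast
        ring
    rw [Finset.sum_congr rfl h3]
    simp_rw [Finset.sum_filter]
    rw [Finset.sum_comm]
    refine Finset.sum_congr rfl fun x hx => ?_
    rw [← Finset.sum_filter, expSum, Finset.mul_sum]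
    refine Finset.sum_congr ?_ fun _ _ => rfl
    ext n
    simp only [Finset.mem_filter, Finset.mem_Icc]
    have := Nat.div_le_self N (max x.1 x.2)
    constructor
    · rintro ⟨⟨h, -⟩, h'⟩
      exact ⟨h, h'⟩
    · rintro ⟨h, h'⟩
      exact ⟨⟨h, h'.trans this⟩, h'⟩
  rw [← h2, Complex.norm_real]
  exact le_abs_self _

/-- The pairs `m₁ ≠ m₂` that are congruent modulo `q`. -/
noncomputable def congruentPairs (N q : ℕ) : Finset (ℕ × ℕ) :=
  (innerPairs N).filter fun x => x.1 ≠ x.2 ∧ (q : ℤ) ∣ (x.1 : ℤ) - x.2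

/-- The coefficients of the off-diagonal form. -/
noncomputable def offDiagCoeff (N : ℕ) (j : ℤ) (x : ℕ × ℕ) : ℂ :=
  1 / N * expSum (outerStart N) (N / max x.1 x.2)
    (((x.1 : ℤ) - x.2 : ℤ) * (j / (4 * Real.pi * N)))

/-- The off-diagonal terms with `m₁ ≡ m₂` modulo `q`. -/
noncomputable def offDiag (N q : ℕ) (j : ℤ) (g : ℕ → ℂ) : ℂ :=
  ∑ x ∈ congruentPairs N q, offDiagCoeff N j x * (g x.1 * conj (g x.2))

lemma abs_sub_le_of_mem {N : ℕ} {x : ℕ × ℕ} (hx : x ∈ innerPairs N) :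
    |(((x.1 : ℤ) - x.2 : ℤ) : ℝ)| ≤ innerRange N := by
  have : |(x.1 : ℤ) - x.2| ≤ innerRange N := by
    simp only [innerPairs, Finset.mem_product, Finset.mem_Icc] at hx
    rw [abs_le]
    omega
  exact_mod_cast this

/-- The term 1 + log N is the diagonal and 4π the pairs with q ∤ m₁ - m₂. What remains no longer
involves a. -/
lemma condVariance_le {N : ℕ} (hN : 0 < N) {g : ℕ → ℂ} (hg : ∀ n ≠ 0, ‖g n‖ = 1) {q a : ℕ}
    {j : ℤ} (hqN : (q : ℝ) ≤ 4 * Real.pi * √N) (hq : q ≠ 0) (haq : a.Coprime q)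
    (hj : |(j : ℝ)| ≤ √N / q) :
    condVariance N g ((a : ℝ) / q + j / (4 * Real.pi * N)) ≤
      1 + Real.log N + 4 * Real.pi + ‖offDiag N q j g‖ := by
  set β : ℝ := j / (4 * Real.pi * N) with hβ
  set T : ℕ × ℕ → ℂ := fun x => g x.1 * conj (g x.2) *
      expSum (outerStart N) (N / max x.1 x.2) (((x.1 : ℤ) - x.2 : ℤ) * ((a : ℝ) / q + β)) with hT
  have hN' : (0 : ℝ) < N := by exact_mod_cast hN
  have hq' : (0 : ℝ) < q := by exact_mod_cast Nat.pos_of_ne_zero hq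
  have hπ := Real.pi_gt_three
  have hM := innerRange_le N
  have hTn : ∀ x ∈ innerPairs N, ‖T x‖ = ‖expSum (outerStart N) (N / max x.1 x.2)
      (((x.1 : ℤ) - x.2 : ℤ) * ((a : ℝ) / q + β))‖ := by
    intro x hx
    simp only [innerPairs, Finset.mem_product, Finset.mem_Icc] at hx
    rw [hT, norm_mul, norm_mul, RCLike.norm_conj, hg _ (by omega), hg _ (by omega), one_mul,
      one_mul]
  have hdiag : ‖∑ x ∈ innerPairs N with x.1 = x.2, T x‖ ≤ N * (1 + Real.log N) := by
    calc _ ≤ ∑ x ∈ innerPairs N with x.1 = x.2, ‖T x‖ := norm_sum_le _ _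
      _ ≤ ∑ m ∈ Finset.Icc 1 N, (N : ℝ) * (1 / m) := by
        refine sum_le_sum_of_injOn Prod.fst ?_ ?_ ?_ fun _ _ => by positivity
        · intro x hx
          simp only [innerPairs, Finset.mem_filter, Finset.mem_product, Finset.mem_Icc] at hx ⊢
          omega
        · intro x hx y hy h
          have hx := (Finset.mem_filter.1 hx).2
          have hy := (Finset.mem_filter.1 hy).2
          exact Prod.ext h (by rw [← hx, ← hy, h])
        · intro x hx
          obtain ⟨hx, hxx⟩ := Finset.mem_filter.1 hx
          rw [hTn x hx, ← hxx, max_self]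
          refine (norm_expSum_le _ (outerStart_pos hN) _).trans ?_
          rw [mul_one_div]
          exact Nat.cast_div_le
      _ ≤ _ := by
        rw [← Finset.mul_sum]
        gcongr
        exact sum_Icc_inv_le N
  have hnd : ‖∑ x ∈ innerPairs N with x.1 ≠ x.2 ∧ ¬ (q : ℤ) ∣ (x.1 : ℤ) - x.2, T x‖ ≤
      N * (4 * Real.pi) := by
    calc _ ≤ ∑ x ∈ innerPairs N with x.1 ≠ x.2 ∧ ¬ (q : ℤ) ∣ (x.1 : ℤ) - x.2, ‖T x‖ :=
          norm_sum_le _ _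
      _ ≤ ∑ x ∈ innerPairs N with x.1 ≠ x.2 ∧ ¬ (q : ℤ) ∣ (x.1 : ℤ) - x.2, (q : ℝ) := by
        refine Finset.sum_le_sum fun x hx => ?_
        obtain ⟨hx, -, hd⟩ := Finset.mem_filter.1 hx
        rw [hTn x hx]
        refine norm_expSum_rat_add_le_of_not_dvd _ _ hq haq hd ?_
        -- From |m₁ - m₂| ≤ √N and |j| ≤ √N/q the perturbation is at most 1/(4πq).
        rw [abs_mul, hβ, abs_div, abs_of_pos (by positivity : 0 < 4 * Real.pi * N)]
        calc _ ≤ √N * (√N / q / (4 * Real.pi * N)) := by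
              gcongr
              exact (abs_sub_le_of_mem hx).trans (innerRange_le_sqrt N)
          _ = 1 / (4 * Real.pi * q) := by
              have := Real.mul_self_sqrt hN'.le
              field_simp
              nlinarith
          _ ≤ _ := by
              gcongr
              linarith
      _ ≤ ∑ x ∈ innerPairs N, (q : ℝ) :=
        Finset.sum_le_sum_of_subset_of_nonneg (Finset.filter_subset _ _) fun _ _ _ => hq'.le
      _ = (innerRange N : ℝ) ^ 2 * q := by
        simp [innerPairs, sq]
      _ ≤ √N * (4 * Real.pi * √N) := by
        gcongr
        exact innerRange_sq_le_sqrt N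
      _ = _ := by
        have := Real.mul_self_sqrt hN'.le
        linear_combination 4 * Real.pi * this
  have hoff : ∑ x ∈ innerPairs N with x.1 ≠ x.2 ∧ (q : ℤ) ∣ (x.1 : ℤ) - x.2, T x =
      N * offDiag N q j g := by
    rw [offDiag, Finset.mul_sum, congruentPairs]
    refine Finset.sum_congr rfl fun x hx => ?_
    obtain ⟨hx, -, hd⟩ := Finset.mem_filter.1 hx
    have : (N : ℂ) ≠ 0 := by exact_mod_cast hN.ne'
    simp only [hT, offDiagCoeff, ← hβ]
    rw [expSum_rat_add_of_dvd _ _ hq hd]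
    field_simp
  have hsplit : ∑ x ∈ innerPairs N, T x = ∑ x ∈ innerPairs N with x.1 = x.2, T x +
      (∑ x ∈ innerPairs N with x.1 ≠ x.2 ∧ ¬ (q : ℤ) ∣ (x.1 : ℤ) - x.2, T x +
        N * offDiag N q j g) := by
    rw [← hoff, ← Finset.sum_filter_add_sum_filter_not _ (fun x : ℕ × ℕ => x.1 = x.2),
      ← Finset.sum_filter_add_sum_filter_not
        (Finset.filter (fun x : ℕ × ℕ => ¬ x.1 = x.2) _)
        (fun x : ℕ × ℕ => (q : ℤ) ∣ (x.1 : ℤ) - x.2), Finset.filter_filter,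
      Finset.filter_filter]
    ring
  refine (condVariance_le_norm hN g _).trans ?_
  have h : ‖∑ x ∈ innerPairs N, T x‖ ≤
      N * (1 + Real.log N) + (N * (4 * Real.pi) + N * ‖offDiag N q j g‖) := by
    rw [hsplit]
    refine (norm_add_le _ _).trans (add_le_add hdiag ((norm_add_le _ _).trans
      (add_le_add hnd ?_)))
    simp
  calc _ ≤ 1 / (N : ℝ) *
        (N * (1 + Real.log N) + (N * (4 * Real.pi) + N * ‖offDiag N q j g‖)) := by gcongr
    _ = _ := by field_simp; ring

/-! ### Second moment of the off-diagonal form. -/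

lemma norm_offDiagCoeff_le {N : ℕ} (hN : 0 < N) {j : ℤ} (hj : j.natAbs ≤ N.sqrt) {x : ℕ × ℕ}
    (hx : x ∈ innerPairs N) (hne : x.1 ≠ x.2) :
    ‖offDiagCoeff N j x‖ ≤
      9 / ((max x.1 x.2 : ℕ) + (((x.1 : ℤ) - x.2).natAbs : ℝ) * (1 + j.natAbs)) := by
  have hN' : (0 : ℝ) < N := by exact_mod_cast hN
  have hx' := hx
  simp only [innerPairs, Finset.mem_product, Finset.mem_Icc] at hx'
  set D := ((x.1 : ℤ) - x.2).natAbs with hD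
  set X := max x.1 x.2 with hX
  have hX0 : 0 < X := by omega
  have hD0 : 0 < D := by omega
  have hDX : D ≤ X := by omega
  have hX0' : (0 : ℝ) < X := by exact_mod_cast hX0
  have hD0' : (0 : ℝ) < D := by exact_mod_cast hD0
  have hDX' : (D : ℝ) ≤ X := by exact_mod_cast hDX
  set E := expSum (outerStart N) (N / X) (((x.1 : ℤ) - x.2 : ℤ) * (j / (4 * Real.pi * N))) with hE
  have hv : ‖offDiagCoeff N j x‖ = 1 / N * ‖E‖ := by
    rw [offDiagCoeff, norm_mul, norm_div, norm_one, Complex.norm_natCast]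
  -- With c the norm of the coefficient, the trivial bound gives cX ≤ 1 and hence cD ≤ 1, while the
  -- geometric sum gives cD|j| ≤ 2π. Adding the three, 2 + 2π < 9.
  have h1 : ‖offDiagCoeff N j x‖ * X ≤ 1 := by
    have : ‖E‖ ≤ N / X := (norm_expSum_le _ (outerStart_pos hN) _).trans Nat.cast_div_le
    rw [hv]
    calc 1 / (N : ℝ) * ‖E‖ * X ≤ 1 / (N : ℝ) * (N / X) * X := by gcongr
      _ = 1 := by field_simp
  have h2 : ‖offDiagCoeff N j x‖ * (D * j.natAbs) ≤ 2 * Real.pi := by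
    rcases eq_or_ne j 0 with rfl | hj0
    · simp only [Int.natAbs_zero, Nat.cast_zero, mul_zero]
      positivity
    have hJ0 : (0 : ℝ) < j.natAbs := by exact_mod_cast Int.natAbs_pos.2 hj0
    have hJ : (j.natAbs : ℝ) ≤ √N := by
      refine Real.le_sqrt_of_sq_le ?_
      exact_mod_cast Nat.le_sqrt'.1 hj
    have habs : |(((x.1 : ℤ) - x.2 : ℤ) : ℝ) * (j / (4 * Real.pi * N))| =
        D * j.natAbs / (4 * Real.pi * N) := by
      rw [abs_mul, abs_div, abs_of_pos (by positivity : 0 < 4 * Real.pi * N), hD,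
        Nat.cast_natAbs, Nat.cast_natAbs]
      push_cast
      ring
    have hle : D * j.natAbs / (4 * Real.pi * N) ≤ (1 / 2 : ℝ) := by
      have hDM : (D : ℝ) ≤ √N := by
        refine le_trans ?_ (innerRange_le_sqrt N)
        exact_mod_cast (by omega)
      have h3 : (D : ℝ) * j.natAbs ≤ N := by
        calc (D : ℝ) * j.natAbs ≤ √N * √N := by gcongr
          _ = N := Real.mul_self_sqrt hN'.le
      rw [div_le_iff₀ (by positivity)]
      nlinarith [Real.pi_gt_three]
    have hpos : 0 < |(((x.1 : ℤ) - x.2 : ℤ) : ℝ) * (j / (4 * Real.pi * N))| := by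
      rw [habs]
      positivity
    have h3 := norm_expSum_le_inv (outerStart N) (N / X) (abs_pos.1 hpos) (habs ▸ hle)
    rw [habs, ← hE] at h3
    rw [hv]
    calc 1 / (N : ℝ) * ‖E‖ * (D * j.natAbs)
        ≤ 1 / (N : ℝ) * (1 / (2 * (D * j.natAbs / (4 * Real.pi * N)))) * (D * j.natAbs) := by
          gcongr
      _ = 2 * Real.pi := by field_simp; norm_num
  rw [le_div_iff₀ (by positivity)]
  have h3 : ‖offDiagCoeff N j x‖ * D ≤ ‖offDiagCoeff N j x‖ * X := by gcongr
  have := Real.pi_lt_d2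
  linarith

/-- Members of the fibre are x = gy. The coefficient bound scales as 1/g and the congruence becomes
q ∣ gD, so `sum_inv_filter_dvd_mul_le` applies. -/
lemma norm_sum_offDiagCoeff_fiber_le {N q : ℕ} (hN : 0 < N) (hq : 0 < q) {j : ℤ}
    (hj : j.natAbs ≤ N.sqrt) {y : ℕ × ℕ} (hy : y.1 ≠ y.2) :
    ‖∑ x ∈ congruentPairs N q with coprimePart x = y, offDiagCoeff N j x‖ ≤
      9 / q * (∑ k ∈ Finset.Icc 1 (innerRange N), (1 / k : ℝ)) *
      ((q.gcd ((y.1 : ℤ) - y.2).natAbs : ℝ) /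
        ((max y.1 y.2 : ℕ) + (((y.1 : ℤ) - y.2).natAbs : ℝ) * (1 + j.natAbs))) := by
  set D := ((y.1 : ℤ) - y.2).natAbs with hD
  set W : ℝ := (max y.1 y.2 : ℕ) + (D : ℝ) * (1 + j.natAbs) with hW
  have hD0 : 0 < D := by omega
  have hD0' : (0 : ℝ) < D := by exact_mod_cast hD0
  have hW0 : 0 < W := by positivity
  have hfib : ∀ x ∈ (congruentPairs N q).filter fun x => coprimePart x = y,
      0 < x.1.gcd x.2 ∧ x.1 = x.1.gcd x.2 * y.1 ∧ x.2 = x.1.gcd x.2 * y.2 := by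
    intro x hx
    simp only [congruentPairs, innerPairs, Finset.mem_filter, Finset.mem_product,
      Finset.mem_Icc] at hx
    rw [← hx.2]
    exact ⟨Nat.gcd_pos_of_pos_left _ hx.1.1.1.1,
      (Nat.mul_div_cancel' (Nat.gcd_dvd_left _ _)).symm,
      (Nat.mul_div_cancel' (Nat.gcd_dvd_right _ _)).symm⟩
  have hdist : ∀ g : ℕ, ((g * y.1 : ℕ) - (g * y.2 : ℕ) : ℤ).natAbs = g * D := by
    intro g
    rw [hD, Nat.cast_mul, Nat.cast_mul, ← mul_sub, Int.natAbs_mul, Int.natAbs_natCast]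
  calc _ ≤ ∑ x ∈ congruentPairs N q with coprimePart x = y, ‖offDiagCoeff N j x‖ :=
        norm_sum_le _ _
    _ ≤ ∑ g ∈ Finset.Icc 1 (innerRange N) with q ∣ g * D, 9 / W * (1 / g : ℝ) := by
        refine sum_le_sum_of_injOn (fun x => x.1.gcd x.2) ?_ ?_ ?_ fun _ _ => by positivity
        · intro x hx
          obtain ⟨hg, h1, h2⟩ := hfib x hx
          simp only [congruentPairs, innerPairs, Finset.mem_filter, Finset.mem_product,
            Finset.mem_Icc] at hx ⊢
          refine ⟨⟨hg, (Nat.gcd_le_left _ hx.1.1.1.1).trans hx.1.1.1.2⟩, ?_⟩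
          have hd := Int.natCast_dvd.1 hx.1.2.2
          generalize x.1.gcd x.2 = g at h1 h2 ⊢
          rwa [h1, h2, hdist] at hd
        · intro x hx x' hx' h
          obtain ⟨-, h1, h2⟩ := hfib x hx
          obtain ⟨-, h1', h2'⟩ := hfib x' hx'
          dsimp only at h
          exact Prod.ext (by rw [h1, h1', h]) (by rw [h2, h2', h])
        · intro x hx
          obtain ⟨hg, h1, h2⟩ := hfib x hx
          simp only [congruentPairs, Finset.mem_filter] at hx
          refine (norm_offDiagCoeff_le hN hj hx.1.1 hx.1.2.1).trans_eq ?_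
          generalize x.1.gcd x.2 = g at hg h1 h2 ⊢
          have hDx : ((x.1 : ℤ) - x.2).natAbs = g * D := by rw [h1, h2, hdist]
          have hmx : max x.1 x.2 = g * max y.1 y.2 := by rw [h1, h2, Nat.mul_max_mul_left]
          have hg' : (0 : ℝ) < g := by exact_mod_cast hg
          rw [hDx, hmx, div_mul_div_comm, mul_one]
          congr 1
          rw [hW]
          push_cast
          ring
    _ = 9 / W * ∑ g ∈ Finset.Icc 1 (innerRange N) with q ∣ g * D, (1 / g : ℝ) :=
        (Finset.mul_sum _ _ _).symm
    _ ≤ 9 / W * ((q.gcd D : ℝ) / q * ∑ k ∈ Finset.Icc 1 (innerRange N), (1 / k : ℝ)) := by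
        gcongr
        exact sum_inv_filter_dvd_mul_le hq _
    _ = _ := by ring

lemma ne_zero_of_mem_congruentPairs {N q : ℕ} {x : ℕ × ℕ} (hx : x ∈ congruentPairs N q) :
    x.1 ≠ 0 ∧ x.2 ≠ 0 := by
  simp only [congruentPairs, innerPairs, Finset.mem_filter, Finset.mem_product,
    Finset.mem_Icc] at hx
  omega

lemma integral_norm_offDiag_sq_le {Ω : Type*} [MeasurableSpace Ω] {μ : Measure Ω}
    [IsProbabilityMeasure μ] {f : ℕ → Ω → ℂ} (hf : IsSteinhaus μ f) {N q : ℕ} (hN : 0 < N)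
    (hq : 0 < q) {j : ℤ} (hj : j.natAbs ≤ N.sqrt) :
    ∫ ω, ‖offDiag N q j fun n => f n ω‖ ^ 2 ∂μ ≤
      162 * (∑ k ∈ Finset.Icc 1 (innerRange N), (1 / k : ℝ)) ^ 3 *
        ((∑ d ∈ q.divisors, (d : ℝ)) / (q : ℝ) ^ 2) * (1 / (1 + (j.natAbs : ℝ))) := by
  set H := ∑ k ∈ Finset.Icc 1 (innerRange N), (1 / k : ℝ) with hH
  have hH0 : 0 ≤ H := Finset.sum_nonneg fun _ _ => by positivity
  set S := Finset.Icc 1 (innerRange N) ×ˢ Finset.Icc 1 (innerRange N) with hS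
  unfold offDiag
  rw [hf.integral_norm_sq_sum fun x hx => ne_zero_of_mem_congruentPairs hx]
  have himg : (congruentPairs N q).image coprimePart ⊆ S.filter fun x => x.1 ≠ x.2 := by
    intro y hy
    obtain ⟨x, hx, rfl⟩ := Finset.mem_image.1 hy
    have h0 := coprimePart_ne_zero (ne_zero_of_mem_congruentPairs hx)
    simp only [congruentPairs, innerPairs, Finset.mem_filter, Finset.mem_product,
      Finset.mem_Icc, hS] at hx ⊢
    refine ⟨⟨⟨by omega, (Nat.div_le_self _ _).trans hx.1.1.2⟩, by omega,
      (Nat.div_le_self _ _).trans hx.1.2.2⟩, fun h => hx.2.1 ?_⟩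
    exact (Nat.div_left_inj (Nat.gcd_dvd_left _ _) (Nat.gcd_dvd_right _ _)).1 h
  calc _ ≤ ∑ y ∈ S with y.1 ≠ y.2, (9 / q * H *
      ((q.gcd ((y.1 : ℤ) - y.2).natAbs : ℝ) /
        ((max y.1 y.2 : ℕ) + (((y.1 : ℤ) - y.2).natAbs : ℝ) * (1 + j.natAbs)))) ^ 2 := by
        refine (Finset.sum_le_sum fun y hy => ?_).trans
          (Finset.sum_le_sum_of_subset_of_nonneg himg fun _ _ _ => sq_nonneg _)
        gcongr
        exact norm_sum_offDiagCoeff_fiber_le hN hq hj (Finset.mem_filter.1 (himg hy)).2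
    _ = 81 * H ^ 2 / q ^ 2 * ∑ y ∈ S with y.1 ≠ y.2, (q.gcd ((y.1 : ℤ) - y.2).natAbs : ℝ) ^ 2 /
        ((max y.1 y.2 : ℕ) + (((y.1 : ℤ) - y.2).natAbs : ℝ) * (1 + j.natAbs)) ^ 2 := by
        refine Eq.trans (Finset.sum_congr rfl fun y _ => ?_) (Finset.mul_sum _ _ _).symm
        rw [mul_pow, div_pow]
        ring
    _ ≤ 81 * H ^ 2 / q ^ 2 * (2 * ((∑ d ∈ q.divisors, (d : ℝ)) / (1 + j.natAbs)) * H) := by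
        gcongr
        exact sum_pairs_gcd_sq_div_le hq (by positivity) _
    _ = _ := by ring

lemma sum_integral_norm_offDiag_sq_le {Ω : Type*} [MeasurableSpace Ω] {μ : Measure Ω}
    [IsProbabilityMeasure μ] {f : ℕ → Ω → ℂ} (hf : IsSteinhaus μ f) {N : ℕ} (hN : 2 ≤ N) :
    ∑ q ∈ Finset.Icc 1 (innerRange N), ∑ j ∈ Finset.Icc (-N.sqrt : ℤ) N.sqrt,
      ∫ ω, ‖offDiag N q j fun n => f n ω‖ ^ 2 ∂μ ≤ 1296 * (1 + Real.log N) ^ 5 := by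
  set H := ∑ k ∈ Finset.Icc 1 (innerRange N), (1 / k : ℝ) with hH
  have hH0 : 0 ≤ H := Finset.sum_nonneg fun _ _ => by positivity
  have hle : ∀ n ≤ N, ∑ k ∈ Finset.Icc 1 n, (1 / k : ℝ) ≤ 1 + Real.log N := fun n hn =>
    (Finset.sum_le_sum_of_subset_of_nonneg (Finset.Icc_subset_Icc_right hn)
      fun _ _ _ => by positivity).trans (sum_Icc_inv_le N)
  have hHL : H ≤ 1 + Real.log N := hle _ (innerRange_le N)
  -- The sum over j is compared with a harmonic sum up to √N + 1, which must not exceed N.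
  have hs : N.sqrt + 1 ≤ N := Nat.sqrt_lt_self hN
  calc _ ≤ ∑ q ∈ Finset.Icc 1 (innerRange N), ∑ j ∈ Finset.Icc (-N.sqrt : ℤ) N.sqrt,
        162 * H ^ 3 * ((∑ d ∈ q.divisors, (d : ℝ)) / (q : ℝ) ^ 2) *
          (1 / (1 + (j.natAbs : ℝ))) := by
        refine Finset.sum_le_sum fun q hq => Finset.sum_le_sum fun j hj => ?_
        rw [Finset.mem_Icc] at hq hj
        exact integral_norm_offDiag_sq_le hf (by omega) hq.1 (by omega)
    _ = 162 * H ^ 3 * (∑ q ∈ Finset.Icc 1 (innerRange N),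
          (∑ d ∈ q.divisors, (d : ℝ)) / (q : ℝ) ^ 2) *
        ∑ j ∈ Finset.Icc (-N.sqrt : ℤ) N.sqrt, 1 / (1 + (j.natAbs : ℝ)) := by
        simp_rw [Finset.mul_sum (Finset.Icc 1 (innerRange N)), Finset.sum_mul_sum]
    _ ≤ 162 * (1 + Real.log N) ^ 3 * (4 * (1 + Real.log N)) * (2 * (1 + Real.log N)) := by
        have hL : 0 ≤ 1 + Real.log N := hH0.trans hHL
        gcongr
        · exact (sum_sigma_div_sq_le _).trans (by gcongr)
        · exact (sum_Icc_neg_inv_one_add_abs_le _).trans (by gcongr; exact hle _ hs)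
    _ = _ := by ring

/-! ### Union bound and conclusion. -/

/-- Distinct inner variables differ by less than q, so none are congruent; the union bound needs
only q ≤ N^0.2. -/
lemma offDiag_eq_zero {N q : ℕ} (hq : innerRange N < q) (j : ℤ) (g : ℕ → ℂ) :
    offDiag N q j g = 0 := by
  refine Finset.sum_eq_zero fun x hx => ?_
  simp only [congruentPairs, innerPairs, Finset.mem_filter, Finset.mem_product,
    Finset.mem_Icc] at hx
  have h := Nat.le_of_dvd (by omega) (Int.natCast_dvd.1 hx.2.2)
  omega

lemma condVariance_le_of_mem_pointSet {N : ℕ} (hN : 0 < N) {g : ℕ → ℂ}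
    (hg : ∀ n ≠ 0, ‖g n‖ = 1) {T : ℝ} (hT : 0 ≤ T)
    (hoff : ∀ q ∈ Finset.Icc 1 (innerRange N), ∀ j ∈ Finset.Icc (-N.sqrt : ℤ) N.sqrt,
      ‖offDiag N q j g‖ ≤ T) {θ : ℝ} (hθ : θ ∈ pointSet N) :
    condVariance N g θ ≤ 1 + Real.log N + 4 * Real.pi + T := by
  obtain ⟨q, a, j, hqN, ha, haq, hcop, hj1, hj2, rfl⟩ := hθ
  have hj : |(j : ℝ)| ≤ √N / q := abs_le.2 ⟨by rw [← neg_div]; exact hj1, hj2⟩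
  refine (condVariance_le hN hg hqN (by omega) hcop hj).trans ?_
  gcongr
  rcases le_or_gt q (innerRange N) with hq | hq
  · refine hoff q (Finset.mem_Icc.2 ⟨by omega, hq⟩) j ?_
    have hjN : |(j : ℝ)| ≤ √N := hj.trans
      (div_le_self (Real.sqrt_nonneg _) (by exact_mod_cast ha.trans haq))
    have h2 : j.natAbs ≤ N.sqrt := by
      rw [Nat.le_sqrt', ← Nat.cast_le (α := ℝ), Nat.cast_pow, Nat.cast_natAbs, Int.cast_abs]
      exact (Real.le_sqrt (abs_nonneg _) (Nat.cast_nonneg _)).1 hjN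
    rw [Finset.mem_Icc]
    omega
  · rw [offDiag_eq_zero hq, norm_zero]
    exact hT

lemma one_sub_le_measureReal {Ω : Type*} [MeasurableSpace Ω] {μ : Measure Ω}
    [IsProbabilityMeasure μ] {f : ℕ → Ω → ℂ} (hf : IsSteinhaus μ f) {N : ℕ} (hN : 2 ≤ N)
    {T : ℝ} (hT : 0 < T) :
    1 - 1296 * (1 + Real.log N) ^ 5 / T ^ 2 ≤ μ.real {ω | ∀ θ ∈ pointSet N,
      condVariance N (fun n => f n ω) θ ≤ 1 + Real.log N + 4 * Real.pi + T} := by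
  set S := {ω | ∀ θ ∈ pointSet N,
      condVariance N (fun n => f n ω) θ ≤ 1 + Real.log N + 4 * Real.pi + T} with hS
  set Q := Finset.Icc 1 (innerRange N)
  set J := Finset.Icc (-N.sqrt : ℤ) N.sqrt
  set B : ℕ × ℤ → Set Ω := fun x => {ω | T ^ 2 ≤ ‖offDiag N x.1 x.2 fun n => f n ω‖ ^ 2} with hB
  set B₀ : Set Ω := {ω | ¬ ∀ n ≠ 0, ‖f n ω‖ = 1} with hB₀
  -- Covering the whole space and using subadditivity avoids any measurability of `S`.
  have hcover : Set.univ ⊆ S ∪ (B₀ ∪ ⋃ x ∈ Q ×ˢ J, B x) := by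
    intro ω _
    by_contra h
    simp only [Set.mem_union, not_or] at h
    obtain ⟨h1, h2, h3⟩ := h
    refine h1 fun θ hθ => condVariance_le_of_mem_pointSet (by omega) (not_not.1 h2) hT.le ?_ hθ
    intro q hq j hj
    by_contra! hlt
    refine h3 (Set.mem_biUnion (Finset.mem_product.2 ⟨hq, hj⟩ : (q, j) ∈ Q ×ˢ J) ?_)
    exact pow_le_pow_left₀ hT.le hlt.le 2
  have hB₀0 : μ.real B₀ = 0 := by
    rw [measureReal_def, show μ B₀ = 0 from ae_iff.1 hf.ae_norm_eq_one, ENNReal.toReal_zero]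
  have hBx : ∀ x : ℕ × ℤ, μ.real (B x) ≤
      (∫ ω, ‖offDiag N x.1 x.2 fun n => f n ω‖ ^ 2 ∂μ) / T ^ 2 := by
    intro x
    rw [le_div_iff₀' (by positivity)]
    exact mul_meas_ge_le_integral_of_nonneg (ae_of_all _ fun _ => by positivity)
      (hf.integrable_norm_sq_sum (fun x hx => ne_zero_of_mem_congruentPairs hx) _) _
  have hsum : ∑ x ∈ Q ×ˢ J, μ.real (B x) ≤ 1296 * (1 + Real.log N) ^ 5 / T ^ 2 := by
    refine (Finset.sum_le_sum fun x _ => hBx x).trans ?_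
    rw [← Finset.sum_div, Finset.sum_product]
    gcongr
    exact sum_integral_norm_offDiag_sq_le hf hN
  have h1 : (1 : ℝ) ≤ μ.real S + (μ.real B₀ + ∑ x ∈ Q ×ˢ J, μ.real (B x)) := by
    calc (1 : ℝ) = μ.real Set.univ := probReal_univ.symm
      _ ≤ μ.real (S ∪ (B₀ ∪ ⋃ x ∈ Q ×ˢ J, B x)) := measureReal_mono hcover
      _ ≤ _ := (measureReal_union_le _ _).trans (add_le_add le_rfl
          ((measureReal_union_le _ _).trans (add_le_add le_rfl
            (measureReal_biUnion_finset_le _ _))))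
  linarith

end SteinhausPoly

theorem proposition3p1 :
    ∃ C : ℝ, 0 < C ∧ ∀ ε : ℝ, 0 < ε →
      ∃ δ : ℕ → ℝ, Tendsto δ atTop (𝓝 0) ∧
        ∀ (Ω : Type*) [MeasurableSpace Ω] (μ : Measure Ω) [IsProbabilityMeasure μ]
          (f : ℕ → Ω → ℂ), SteinhausPoly.IsSteinhaus μ f →
          ∀ N : ℕ, 1 - δ N ≤ μ.real {ω | ∀ θ ∈ SteinhausPoly.pointSet N,
            SteinhausPoly.condVariance N (fun n => f n ω) θ
              ≤ C * Real.log N ^ (5 / 2 + ε)} := by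
  -- For N ≥ 3 one has 1 ≤ log N ≤ T, so 1 + log N + 4π + T ≤ (3 + 4π)T ≤ 16T. In δ, 41472 = 1296 ·
  -- 2⁵ comes from 1 + log N ≤ 2 log N, and the value 1 makes N < 3 trivial.
  refine ⟨16, by norm_num, fun ε hε => ?_⟩
  refine ⟨fun N => if N < 3 then 1 else 41472 * Real.log N ^ (-(2 * ε)), ?_, ?_⟩
  · have h : Tendsto (fun N : ℕ => 41472 * Real.log N ^ (-(2 * ε))) atTop (𝓝 (41472 * 0)) :=
      ((tendsto_rpow_neg_atTop (by positivity)).comp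
        (Real.tendsto_log_atTop.comp tendsto_natCast_atTop_atTop)).const_mul _
    rw [mul_zero] at h
    refine h.congr' ?_
    filter_upwards [eventually_ge_atTop 3] with N hN
    rw [if_neg (by omega)]
  · intro Ω _ μ _ f hf N
    dsimp only
    split_ifs with hN
    · rw [sub_self]
      exact measureReal_nonneg
    have hN3 : (3 : ℝ) ≤ N := by exact_mod_cast not_lt.1 hN
    have hlog : 1 ≤ Real.log N := by
      rw [Real.le_log_iff_exp_le (by linarith)]
      linarith [Real.exp_one_lt_d9]
    have hlog0 : 0 < Real.log N := by linarith
    set T := Real.log N ^ (5 / 2 + ε) with hT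
    have hT0 : 0 < T := Real.rpow_pos_of_pos hlog0 _
    have hlT : Real.log N ≤ T := by
      conv_lhs => rw [← Real.rpow_one (Real.log N)]
      exact Real.rpow_le_rpow_of_exponent_le hlog (by linarith)
    have hT2 : T ^ 2 = Real.log N ^ 5 * Real.log N ^ (2 * ε) := by
      rw [hT, ← Real.rpow_natCast, ← Real.rpow_natCast, ← Real.rpow_mul hlog0.le,
        ← Real.rpow_add hlog0]
      congr 1
      push_cast
      ring
    have hmono : {ω | ∀ θ ∈ SteinhausPoly.pointSet N, SteinhausPoly.condVariance N
          (fun n => f n ω) θ ≤ 1 + Real.log N + 4 * Real.pi + T} ⊆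
        {ω | ∀ θ ∈ SteinhausPoly.pointSet N,
          SteinhausPoly.condVariance N (fun n => f n ω) θ ≤ 16 * T} := by
      intro ω hω θ hθ
      have := hω θ hθ
      have := Real.pi_lt_d2
      linarith
    refine le_trans ?_ ((SteinhausPoly.one_sub_le_measureReal hf (by omega) hT0).trans
      (measureReal_mono hmono))
    have hpow : 0 < Real.log N ^ (2 * ε) := Real.rpow_pos_of_pos hlog0 _
    gcongr
    rw [hT2, Real.rpow_neg hlog0.le, div_le_iff₀ (by positivity)]
    calc 1296 * (1 + Real.log N) ^ 5 ≤ 1296 * (2 * Real.log N) ^ 5 := by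
          gcongr
          linarith
      _ = _ := by
          field_simp
          ring
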